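/- Let $p$ be a prime and let $\Bbbk$ be a field of characteristic $p$ that is $F$-finite, i.e. finitely generated as a module over its subfield $\Bbbk^p$. Let $g_1,\dots,g_m\in\Bbbk[x]=\Bbbk[x_1,\dots,x_n]$ be nonzero polynomials that generate a proper ideal $\mathfrak a$, and let $\mathfrak b$ be a proper monomial ideal of $\Bbbk[x]$ (an ideal generated by monomials) with $\mathfrak a\subseteq\sqrt{\mathfrak b}$. For an $F$-finite field $\mathbb L$ containing $\Bbbk$, let $\mathfrak b_{\mathbb L}=\mathfrak b\,\mathbb L[x]$. For a nonzero $\mathbb L$-linear combination $g$ of $g_1,\dots,g_m$, the $F$-threshold of $g$ with respect to $\mathfrak b_{\mathbb L}$ is \[ \operatorname{ft}^{\mathfrak b_{\mathbb L}}(g)=\sup_{e\ge 0}\frac{\max\{k\in\mathbb N: g^k\notin\mathfrak b_{\mathbb L}^{[p^e]}\}}{p^e}\in\mathbb R , \] where $\mathfrak b_{\mathbb L}^{[q]}$ is the ideal generated by the $q$-th powers of all elements of $\mathfrak b_{\mathbb L}$. If $Z$ is a subset of $\mathbb A^m_{\Bbbk}=\operatorname{Spec}\Bbbk[z_1,\dots,z_m]$,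 let $Z_{\mathbb L}\subseteq\mathbb A^m_{\mathbb L}$ be its base change, i.e. its preimage under the projection $\mathbb A^m_{\mathbb L}\to\mathbb A^m_{\Bbbk}$ (for $Z$ closed or locally closed, the subset given by the same equations, respectively equations and inequations). Then the following hold. (1) Let $S(\mathbb L)$ be the set of the numbers $\operatorname{ft}^{\mathfrak b_{\mathbb L}}(g)$, where $g$ ranges over all nonzero $\mathbb L$-linear combinations of $g_1,\dots,g_m$. The union $S=\bigcup_{\mathbb L}S(\mathbb L)$ over all $F$-finite fields $\mathbb L$ containing $\Bbbk$ is a finite set. (2) For each $\lambda\in S$ there exists a locally closed set $Z^\lambda\subseteq\mathbb A^m_{\Bbbk}$ such that for every $F$-finite field $\mathbb L$ containing $\Bbbk$ and every $\gamma=(\gamma_1,\dots,\gamma_m)\in\mathbb L^m$ for which $g=\gamma_1g_1+\cdots+\gamma_mg_m$ is nonzero, \[ \operatorname{ft}^{\mathfrak b_{\mathbb L}}(g)=\lambda\iff\gamma\in Z^\lambda_{\mathbb L}. \] -/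

import Mathlib

universe u v

open MvPolynomial

namespace FThr

/-- A ring `K` of characteristic `p` is F-finite if the Frobenius endomorphism `x ↦ x ^ p` makes
`K` a finite module over itself. -/
def IsFFinite (p : ℕ) (K : Type*) [CommRing K] [ExpChar K p] : Prop :=
  (frobenius K p).Finite

/-- The Frobenius power `𝔟^[q]`: the ideal generated by the `q`-th powers of all elements
of `𝔟`. -/
def frobPow {R : Type*} [CommRing R] (b : Ideal R) (q : ℕ) : Ideal R :=
  Ideal.span ((fun f : R => f ^ q) '' (b : Set R))

/-- `ν_𝔞^𝔟(q) = max {k : 𝔞 ^ k ⊄ 𝔟^[q]}`. -/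
noncomputable def nu {R : Type*} [CommRing R] (a b : Ideal R) (q : ℕ) : ℕ :=
  sSup {k : ℕ | ¬ a ^ k ≤ frobPow b q}

/-- The F-threshold `ft^𝔟(𝔞)`, the supremum of `ν_𝔞^𝔟(q) / q` over all powers `q` of `p`. -/
noncomputable def fThreshold (p : ℕ) {R : Type*} [CommRing R] (a b : Ideal R) : ℝ :=
  ⨆ e : ℕ, (nu a b (p ^ e) : ℝ) / (p : ℝ) ^ e

/-- A monomial ideal of a polynomial ring: an ideal generated by monomials. -/
def IsMonomialIdeal {σ k : Type*} [CommRing k] (b : Ideal (MvPolynomial σ k)) : Prop :=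
  ∃ s : Set (σ →₀ ℕ), b = Ideal.span ((fun d => monomial d (1 : k)) '' s)

/-- The extension `𝔡_L` of an ideal `𝔡` of `k[x]` to `L[x]`. -/
noncomputable def extend {σ k : Type*} (L : Type*) [Field k] [Field L] [Algebra k L]
    (d : Ideal (MvPolynomial σ k)) : Ideal (MvPolynomial σ L) :=
  d.map (MvPolynomial.map (algebraMap k L))

/-- The linear combination `γ₁ g₁ + ⋯ + γₘ gₘ` in `L[x]`. -/
noncomputable def linComb {σ k L : Type*} [Field k] [Field L] [Algebra k L] {m : ℕ}
    (g : Fin m → MvPolynomial σ k) (γ : Fin m → L) : MvPolynomial σ L :=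
  ∑ i, C (γ i) * MvPolynomial.map (algebraMap k L) (g i)

/-- Affine `m`-space over a field: the prime spectrum of the polynomial ring in `m` variables, with
the Zariski topology. -/
abbrev Aff (m : ℕ) (k : Type*) [Field k] : Type _ :=
  PrimeSpectrum (MvPolynomial (Fin m) k)

/-- The closed point of `𝔸ᵐ_L` with coordinates `(γ₁, …, γₘ) ∈ Lᵐ`: the ideal of all polynomials
over `L` that vanish at `γ`. -/
def ratPoint {m : ℕ} {L : Type*} [Field L] (γ : Fin m → L) : Aff m L :=
  pointToPoint (k := L) γ

/-- The base change `V_L ⊆ 𝔸ᵐ_L` of a subset `V ⊆ 𝔸ᵐ_k`: its preimage under the projection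
`𝔸ᵐ_L → 𝔸ᵐ_k`. -/
def baseChange {m : ℕ} {k : Type*} (L : Type*) [Field k] [Field L] [Algebra k L]
    (V : Set (Aff m k)) : Set (Aff m L) :=
  PrimeSpectrum.comap (MvPolynomial.map (algebraMap k L)) ⁻¹' V

/-- The set `S(L)` of all F-thresholds with respect to `𝔟_L` of nonzero `L`-linear combinations of
`g₁, …, gₘ`. -/
def thresholdsOver (p : ℕ) {n m : ℕ} {k : Type*} (L : Type*) [Field k] [Field L] [Algebra k L]
    (g : Fin m → MvPolynomial (Fin n) k) (b : Ideal (MvPolynomial (Fin n) k)) : Set ℝ :=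
  {t | ∃ γ : Fin m → L, linComb g γ ≠ 0 ∧
    fThreshold p (Ideal.span {linComb g γ}) (extend L b) = t}

/-- The union `S` of all `S(L)`, where `L` ranges over the F-finite extension fields of `k`. -/
def thresholds (p : ℕ) [Fact p.Prime] {n m : ℕ} {k : Type u} [Field k]
    (g : Fin m → MvPolynomial (Fin n) k) (b : Ideal (MvPolynomial (Fin n) k)) : Set ℝ :=
  {t | ∃ (L : Type v) (_ : Field L) (_ : Algebra k L) (_ : CharP L p),
    IsFFinite p L ∧ t ∈ thresholdsOver p L g b}

/-! Well-definedness: the equations of a base change, and existence of the maximum and finiteness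
of the supremum in the definition of the F-threshold of an element. -/

/-- An `L`-rational point lies in the base change of the closed set defined by `H` if and only if
it satisfies the equations in `H`. -/
theorem ratPoint_mem_baseChange_zeroLocus {m : ℕ} {k L : Type*} [Field k] [Field L]
    [Algebra k L] (H : Set (MvPolynomial (Fin m) k)) (γ : Fin m → L) :
    ratPoint γ ∈ baseChange L (PrimeSpectrum.zeroLocus H) ↔ ∀ h ∈ H, aeval γ h = 0 := by
  simp only [baseChange, Set.mem_preimage, PrimeSpectrum.mem_zeroLocus, Set.subset_def,
    SetLike.mem_coe, PrimeSpectrum.comap_asIdeal, Ideal.mem_comap]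
  refine forall₂_congr fun h _ => ?_
  change MvPolynomial.map (algebraMap k L) h ∈ vanishingIdeal L {γ} ↔ _
  rw [mem_vanishingIdeal_singleton_iff, aeval_map_algebraMap]

theorem frobPow_ne_top {R : Type*} [CommRing R] {b : Ideal R} (hb : b ≠ ⊤) {q : ℕ} (hq : q ≠ 0) :
    frobPow b q ≠ ⊤ := by
  intro h
  apply hb
  rw [eq_top_iff, ← h, frobPow, Ideal.span_le]
  rintro _ ⟨f, hf, rfl⟩
  exact Ideal.pow_mem_of_mem b hf q (Nat.pos_of_ne_zero hq)

theorem le_of_not_pow_le {R : Type*} [CommRing R] {b : Ideal R} {f : R} {N : ℕ}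
    (hN : f ^ N ∈ b) (q k : ℕ) (hk : ¬ (Ideal.span {f}) ^ k ≤ frobPow b q) : k ≤ N * q := by
  by_contra hlt
  apply hk
  rw [Ideal.span_singleton_pow, Ideal.span_singleton_le_iff_mem]
  have h1 : f ^ (N * q) ∈ frobPow b q := by
    rw [pow_mul]
    exact Ideal.subset_span ⟨f ^ N, hN, rfl⟩
  exact Ideal.mem_of_dvd _ (pow_dvd_pow f (by omega)) h1

theorem isGreatest_nu {R : Type*} [CommRing R] {b : Ideal R} (hb : b ≠ ⊤) {f : R}
    (hf : f ∈ b.radical) {q : ℕ} (hq : q ≠ 0) :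
    IsGreatest {k : ℕ | ¬ (Ideal.span {f}) ^ k ≤ frobPow b q} (nu (Ideal.span {f}) b q) := by
  obtain ⟨N, hN⟩ := hf
  have hbdd : BddAbove {k : ℕ | ¬ (Ideal.span {f}) ^ k ≤ frobPow b q} :=
    ⟨N * q, fun k hk => le_of_not_pow_le hN q k hk⟩
  refine ⟨Nat.sSup_mem ⟨0, ?_⟩ hbdd, fun k hk => le_csSup hbdd hk⟩
  simpa [top_le_iff] using frobPow_ne_top hb hq

theorem bddAbove_nu_div {p : ℕ} [Fact p.Prime] {R : Type*} [CommRing R] {b : Ideal R}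
    (hb : b ≠ ⊤) {f : R} (hf : f ∈ b.radical) :
    BddAbove (Set.range fun e : ℕ => (nu (Ideal.span {f}) b (p ^ e) : ℝ) / (p : ℝ) ^ e) := by
  have hp : 0 < p := (Fact.out : p.Prime).pos
  obtain ⟨N, hN⟩ := id hf
  refine ⟨N, ?_⟩
  rintro _ ⟨e, rfl⟩
  have h := le_of_not_pow_le hN (p ^ e) _ (isGreatest_nu hb hf (pow_pos hp e).ne').1
  rw [div_le_iff₀ (by positivity)]
  exact_mod_cast h

end FThr

namespace FThr

/-! Write `ν(q)` for `nu (Ideal.span {f}) b q`. Over a perfect field, each `r = ν(p^(i+s)) - p^s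
ν(p^i)` is an exponent below `p^s` at which the `p^s`-th root ideals of the powers of `f` drop
(`mem_drops`). If `f` has degree at most `D`, such drops are visible in the space of polynomials of
degree at most `D`, so their number is at most its dimension `M`, whatever `s` is (`card_drops_le`).
By pigeonhole some `i < j ≤ M` share the same `r` for infinitely many `s`; dividing by `p^s` gives
`ft(f) (p^j - p^i) = ν(p^j) - ν(p^i)` (`exists_fThreshold_mul_eq`), which leaves finitely many
values.

For a monomial ideal, membership in a Frobenius power means that certain coefficients vanish.
Thresholds therefore survive passage to an algebraic closure (`fThreshold_extension`), and `ft ≤ c`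
is a closed condition over `k` (`fThreshold_le_iff_mem_baseChange`). Removing the finitely many
smaller values leaves a locally closed set. -/

theorem frobPow_eq_map {R : Type*} [CommRing R] (p : ℕ) [ExpChar R p] (b : Ideal R) (e : ℕ) :
    frobPow b (p ^ e) = b.map (iterateFrobenius R p e) :=
  rfl

/-! ### Coordinates over the ring of `p^e`-th powers -/

section CartierMaps

variable {σ : Type*} {L : Type*} [Field L] {p : ℕ} [Fact p.Prime] [CharP L p] [PerfectRing L p]

/-- The coordinatewise remainders of an exponent modulo `q`. -/
noncomputable def expMod (q : ℕ) (d : σ →₀ ℕ) : σ →₀ ℕ :=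
  d.mapRange (· % q) (Nat.zero_mod q)

/-- The coordinatewise quotients of an exponent by `q`. -/
noncomputable def expDiv (q : ℕ) (d : σ →₀ ℕ) : σ →₀ ℕ :=
  d.mapRange (· / q) (Nat.zero_div q)

theorem expMod_add_nsmul (q : ℕ) (d a : σ →₀ ℕ) : expMod q (d + q • a) = expMod q d := by
  ext i; simp [expMod]

theorem expDiv_add_nsmul {q : ℕ} (hq : 0 < q) (d a : σ →₀ ℕ) :
    expDiv q (d + q • a) = expDiv q d + a := by
  ext i; simp [expDiv, Nat.add_mul_div_left _ _ hq]

theorem expMod_add_nsmul_expDiv (q : ℕ) (d : σ →₀ ℕ) : expMod q d + q • expDiv q d = d := by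
  ext i; simp [expDiv, expMod, Nat.mod_add_div]

/-- The coefficient of `x ^ α` of a polynomial `u` over a perfect field, in the basis of the
monomials with exponents less than `p ^ e` over the ring of `p ^ e`-th powers, read off as its
`p ^ e`-th root. -/
noncomputable def rootCoeff (L : Type*) [Field L] (p : ℕ) [Fact p.Prime] [CharP L p]
    [PerfectRing L p] (e : ℕ) (α : σ →₀ ℕ) : MvPolynomial σ L →+ MvPolynomial σ L :=
  open Classical in
  ((basisMonomials σ L).constr L fun d =>
    if expMod (p ^ e) d = α then monomial (expDiv (p ^ e) d) (1 : L) else 0).toAddMonoidHom.comp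
    (MvPolynomial.map (iterateFrobeniusEquiv L p e).symm.toRingHom).toAddMonoidHom

open Classical in
theorem rootCoeff_monomial (e : ℕ) (α d : σ →₀ ℕ) (c : L) :
    rootCoeff L p e α (monomial d c) =
      if expMod (p ^ e) d = α then
        monomial (expDiv (p ^ e) d) ((iterateFrobeniusEquiv L p e).symm c) else 0 := by
  have h : ∀ c : L, monomial d c = c • basisMonomials σ L d := fun c => by
    simp [smul_monomial]
  simp only [rootCoeff, AddMonoidHom.comp_apply, LinearMap.toAddMonoidHom_coe,
    RingHom.toAddMonoidHom_eq_coe, AddMonoidHom.coe_coe, map_monomial]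
  rw [h, map_smul, Module.Basis.constr_basis]
  split_ifs <;> simp [smul_monomial]

omit [PerfectRing L p] in
theorem add_pow_char_pow' (u v : MvPolynomial σ L) (e : ℕ) :
    (u + v) ^ p ^ e = u ^ p ^ e + v ^ p ^ e :=
  add_pow_char_pow ..

/-- Both sides are additive in `u` and in `h`; on monomials, a `p^e`-th power shifts exponents by
multiples of `p^e` and leaves remainders unchanged. -/
theorem rootCoeff_mul_pow (e : ℕ) (α : σ →₀ ℕ) (u h : MvPolynomial σ L) :
    rootCoeff L p e α (u * h ^ p ^ e) = rootCoeff L p e α u * h := by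
  classical
  have hq : 0 < p ^ e := pow_pos (Fact.out : p.Prime).pos e
  induction u using MvPolynomial.induction_on' with
  | add u v hu hv => rw [add_mul, map_add, hu, hv, map_add, add_mul]
  | monomial d c =>
    induction h using MvPolynomial.induction_on' with
    | add u v hu hv => rw [add_pow_char_pow', mul_add, map_add, hu, hv, mul_add]
    | monomial a x =>
      rw [monomial_pow, monomial_mul, rootCoeff_monomial, rootCoeff_monomial, expMod_add_nsmul,
        expDiv_add_nsmul hq]
      split_ifs
      · rw [monomial_mul, map_mul, ← iterateFrobeniusEquiv_def, RingEquiv.symm_apply_apply]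
      · rw [zero_mul]

/-- The exponents all of whose entries are less than `q`. -/
noncomputable def smallExps (σ : Type*) [Fintype σ] (q : ℕ) : Finset (σ →₀ ℕ) :=
  open Classical in
  (Fintype.piFinset fun _ : σ => Finset.range q).map Finsupp.equivFunOnFinite.symm.toEmbedding

theorem expMod_mem_smallExps [Fintype σ] {q : ℕ} (hq : 0 < q) (d : σ →₀ ℕ) :
    expMod q d ∈ smallExps σ q := by
  classical
  simp only [smallExps, Finset.mem_map_equiv, Fintype.mem_piFinset, Finset.mem_range]
  intro i
  simpa [expMod] using Nat.mod_lt _ hq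

theorem sum_monomial_mul_rootCoeff_pow [Fintype σ] (e : ℕ) (u : MvPolynomial σ L) :
    ∑ α ∈ smallExps σ (p ^ e), monomial α (1 : L) * rootCoeff L p e α u ^ p ^ e = u := by
  classical
  have hq : 0 < p ^ e := pow_pos (Fact.out : p.Prime).pos e
  induction u using MvPolynomial.induction_on' with
  | add u v hu hv =>
    simp only [map_add, add_pow_char_pow', mul_add, Finset.sum_add_distrib, hu, hv]
  | monomial d c =>
    rw [Finset.sum_eq_single_of_mem _ (expMod_mem_smallExps hq d)]
    · rw [rootCoeff_monomial, if_pos rfl, monomial_pow, monomial_mul, expMod_add_nsmul_expDiv,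
        one_mul, ← iterateFrobeniusEquiv_def, RingEquiv.apply_symm_apply]
    · intro α _ hα
      rw [rootCoeff_monomial, if_neg (Ne.symm hα), zero_pow hq.ne', mul_zero]

/-- Frobenius makes the polynomial ring free over itself, so membership can be tested coordinate by
coordinate. -/
theorem mem_frobPow_iff [Fintype σ] {J : Ideal (MvPolynomial σ L)} {e : ℕ}
    {u : MvPolynomial σ L} :
    u ∈ frobPow J (p ^ e) ↔ ∀ α, rootCoeff L p e α u ∈ J := by
  constructor
  · intro hu α
    induction hu using Submodule.span_induction with
    | mem x hx =>
      obtain ⟨h, hh, rfl⟩ := hx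
      have h1 := rootCoeff_mul_pow (p := p) e α 1 h
      rw [one_mul] at h1
      simp only [h1]
      exact J.mul_mem_left _ hh
    | zero => simp
    | add x y _ _ hx hy => rw [map_add]; exact J.add_mem hx hy
    | smul a x hx' hx =>
      -- The hypothesis on `x` alone says nothing about `a * x`; a second induction treats all
      -- multiples at once.
      clear hx
      rw [smul_eq_mul]
      induction hx' using Submodule.span_induction generalizing a with
      | mem x hx =>
        obtain ⟨h, hh, rfl⟩ := hx
        simp only [rootCoeff_mul_pow]
        exact J.mul_mem_left _ hh
      | zero => simp
      | add x y _ _ hx hy => rw [mul_add, map_add]; exact J.add_mem (hx a) (hy a)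
      | smul b x _ hx => rw [smul_eq_mul, ← mul_assoc]; exact hx _
  · intro hu
    rw [← sum_monomial_mul_rootCoeff_pow (p := p) e u]
    exact Ideal.sum_mem _ fun α _ =>
      Ideal.mul_mem_left _ _ (Ideal.subset_span ⟨_, hu α, rfl⟩)

theorem degree_expDiv_mul_le (q : ℕ) (d : σ →₀ ℕ) : (expDiv q d).degree * q ≤ d.degree := by
  conv_rhs => rw [← expMod_add_nsmul_expDiv q d, map_add, map_nsmul, smul_eq_mul, mul_comm]
  exact Nat.le_add_left _ _

theorem rootCoeff_mem_restrictTotalDegree {e D : ℕ} (α : σ →₀ ℕ) {u : MvPolynomial σ L}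
    (hu : u.totalDegree ≤ D * p ^ e) :
    rootCoeff L p e α u ∈ restrictTotalDegree σ L D := by
  classical
  have hq : 0 < p ^ e := pow_pos (Fact.out : p.Prime).pos e
  rw [u.as_sum, map_sum]
  refine Submodule.sum_mem _ fun d hd => ?_
  rw [rootCoeff_monomial]
  split_ifs
  · rw [mem_restrictTotalDegree]
    refine (totalDegree_monomial_le _ _).trans ?_
    have h1 : d.degree ≤ D * p ^ e := (le_totalDegree hd).trans hu
    exact Nat.le_of_mul_le_mul_right ((degree_expDiv_mul_le _ d).trans h1) hq
  · exact Submodule.zero_mem _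

end CartierMaps

theorem frobPow_frobPow {R : Type*} [CommRing R] (p : ℕ) [ExpChar R p] (b : Ideal R) (i s : ℕ) :
    frobPow (frobPow b (p ^ i)) (p ^ s) = frobPow b (p ^ (i + s)) := by
  rw [frobPow_eq_map, frobPow_eq_map, frobPow_eq_map, Ideal.map_map, ← iterateFrobenius_add,
    add_comm]

/-- Each strict drop in the chain costs at least one dimension. -/
theorem card_le_finrank_of_antitone {K V : Type*} [DivisionRing K] [AddCommGroup V] [Module K V]
    [FiniteDimensional K V] (W : ℕ → Submodule K V) (hW : Antitone W) (D : Finset ℕ)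
    (hD : ∀ r ∈ D, W (r + 1) ≠ W r) : D.card ≤ Module.finrank K V := by
  have key : ∀ N, (D.filter (· < N)).card + Module.finrank K (W N) ≤ Module.finrank K V := by
    intro N
    induction N with
    | zero => simpa using Submodule.finrank_le (W 0)
    | succ N ih =>
      have hle : W (N + 1) ≤ W N := hW N.le_succ
      by_cases hN : N ∈ D
      · have hlt := Submodule.finrank_lt_finrank_of_lt (lt_of_le_of_ne hle (hD N hN))
        have h1 : D.filter (· < N + 1) ⊆ insert N (D.filter (· < N)) := by
          intro r hr
          simp only [Finset.mem_filter, Finset.mem_insert] at hr ⊢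
          grind
        have h2 := (Finset.card_le_card h1).trans (Finset.card_insert_le _ _)
        omega
      · have hle' := Submodule.finrank_mono hle
        have h1 : D.filter (· < N + 1) ⊆ D.filter (· < N) := by
          intro r hr
          simp only [Finset.mem_filter] at hr ⊢
          grind
        have h2 := Finset.card_le_card h1
        omega
  have h := key (D.sup id + 1)
  have hlt : ∀ r ∈ D, r < D.sup id + 1 := fun r hr =>
    Nat.lt_succ_iff.2 (Finset.le_sup (f := id) hr)
  rw [Finset.filter_true_of_mem hlt] at h
  omega

/-- The number of monomials of degree at most `D` in `n` variables. -/
noncomputable def monomialCount (n D : ℕ) : ℕ :=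
  Nat.card {d : Fin n →₀ ℕ | d.degree ≤ D}

instance finite_degree_le (n D : ℕ) : Finite {d : Fin n →₀ ℕ | d.degree ≤ D} :=
  (Finsupp.finite_of_degree_le D).to_subtype

instance finiteDimensional_restrictTotalDegree (n D : ℕ) (L : Type*) [Field L] :
    FiniteDimensional L (restrictTotalDegree (Fin n) L D) :=
  have : Finite {d : Fin n →₀ ℕ | (d.sum fun _ e => e) ≤ D} := finite_degree_le n D
  Module.Finite.of_basis (basisRestrictSupport L _)

theorem finrank_restrictTotalDegree (n D : ℕ) (L : Type*) [Field L] :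
    Module.finrank L (restrictTotalDegree (Fin n) L D) = monomialCount n D :=
  Module.finrank_eq_nat_card_basis (basisRestrictSupport L _)

/-! ### Frobenius root ideals and their drops -/

section Perfect

variable {n : ℕ} {L : Type*} [Field L] {p : ℕ} [Fact p.Prime] [CharP L p] [PerfectRing L p]

/-- The exponents `r` at which the Frobenius root ideal of the powers of `f` drops. -/
def drops (p : ℕ) {R : Type*} [CommRing R] (f : R) (s : ℕ) : Set ℕ :=
  {r | ∃ J : Ideal R, f ^ (r + 1) ∈ frobPow J (p ^ s) ∧ f ^ r ∉ frobPow J (p ^ s)}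

/-- The `p ^ s`-th Frobenius root ideal of `u`. -/
noncomputable def rootIdeal (p : ℕ) [Fact p.Prime] [CharP L p] [PerfectRing L p]
    (s : ℕ) (u : MvPolynomial (Fin n) L) : Ideal (MvPolynomial (Fin n) L) :=
  Ideal.span (Set.range fun α => rootCoeff L p s α u)

theorem rootIdeal_le_iff {J : Ideal (MvPolynomial (Fin n) L)} {s : ℕ}
    {u : MvPolynomial (Fin n) L} : rootIdeal p s u ≤ J ↔ u ∈ frobPow J (p ^ s) := by
  rw [mem_frobPow_iff, rootIdeal, Ideal.span_le, Set.range_subset_iff]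
  rfl

theorem rootIdeal_pow_antitone (s : ℕ) (f : MvPolynomial (Fin n) L) :
    Antitone fun r => rootIdeal p s (f ^ r) := by
  intro r t hrt
  exact rootIdeal_le_iff.2 (Ideal.mem_of_dvd _ (pow_dvd_pow f hrt) (rootIdeal_le_iff.1 le_rfl))

theorem card_drops_le {D s : ℕ} {f : MvPolynomial (Fin n) L} (hf : f.totalDegree ≤ D)
    (E : Finset ℕ) (hE : ∀ r ∈ E, r < p ^ s ∧ r ∈ drops p f s) :
    E.card ≤ monomialCount n D := by
  rw [← finrank_restrictTotalDegree n D L]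
  let V := restrictTotalDegree (Fin n) L D
  refine card_le_finrank_of_antitone
    (fun r => ((rootIdeal p s (f ^ r)).restrictScalars L).comap V.subtype) ?_ E ?_
  · intro r t hrt x hx
    exact rootIdeal_pow_antitone s f hrt hx
  · intro r hr heq
    obtain ⟨hlt, J, hJ1, hJ2⟩ := hE r hr
    rw [mem_frobPow_iff] at hJ2
    push Not at hJ2
    obtain ⟨α, hα⟩ := hJ2
    -- Since `r < p^s`, all coordinates of `f^r` have degree at most `D`, so a coordinate witnessing
    -- the drop lies in `V`.
    have hdeg : (f ^ r).totalDegree ≤ D * p ^ s :=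
      (totalDegree_pow f r).trans ((Nat.mul_le_mul hlt.le hf).trans_eq (mul_comm _ _))
    let x : V := ⟨_, rootCoeff_mem_restrictTotalDegree (p := p) α hdeg⟩
    have hx : x ∈ ((rootIdeal p s (f ^ r)).restrictScalars L).comap V.subtype :=
      Ideal.subset_span ⟨α, rfl⟩
    rw [← heq] at hx
    exact hα (rootIdeal_le_iff.2 hJ1 hx)

theorem pow_mem_frobPow_iff {J : Ideal (MvPolynomial (Fin n) L)} {s : ℕ}
    {u : MvPolynomial (Fin n) L} : u ^ p ^ s ∈ frobPow J (p ^ s) ↔ u ∈ J := by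
  classical
  refine ⟨fun h => ?_, fun h => Ideal.subset_span ⟨u, h, rfl⟩⟩
  have h1 := mem_frobPow_iff.1 h 0
  rw [← one_mul (u ^ p ^ s), rootCoeff_mul_pow, ← C_1, C_apply, rootCoeff_monomial,
    if_pos (by ext; simp [expMod])] at h1
  have h2 : expDiv (p ^ s) (0 : Fin n →₀ ℕ) = 0 := by ext; simp [expDiv]
  rw [h2, map_one] at h1
  simpa using h1

/-- Frobenius powers commute with colons by one element, as the coordinate maps pull `h` out of its
`p^s`-th power. -/
theorem mem_frobPow_colon_iff {J : Ideal (MvPolynomial (Fin n) L)} {s : ℕ}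
    {u h : MvPolynomial (Fin n) L} :
    u ∈ frobPow (J.colon {h}) (p ^ s) ↔ u * h ^ p ^ s ∈ frobPow J (p ^ s) := by
  simp only [mem_frobPow_iff, rootCoeff_mul_pow, Submodule.mem_colon_singleton, smul_eq_mul]

theorem mem_drops {b : Ideal (MvPolynomial (Fin n) L)} {f : MvPolynomial (Fin n) L} {i s a c : ℕ}
    (ha : p ^ s * a ≤ c) (h1 : f ^ c ∉ frobPow b (p ^ (i + s)))
    (h2 : f ^ (c + 1) ∈ frobPow b (p ^ (i + s))) : c - p ^ s * a ∈ drops p f s := by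
  -- The colon by `f^a` restores the factor `f^(p^s a)` missing from `f^c`.
  refine ⟨(frobPow b (p ^ i)).colon {f ^ a}, ?_, ?_⟩
  · rwa [mem_frobPow_colon_iff, frobPow_frobPow, ← pow_mul, ← pow_add, mul_comm a,
      Nat.sub_add_comm ha |>.symm, Nat.sub_add_cancel (by omega)]
  · rwa [mem_frobPow_colon_iff, frobPow_frobPow, ← pow_mul, ← pow_add, mul_comm a,
      Nat.sub_add_cancel ha]

end Perfect

/-! ### Thresholds and ideal membership -/

section Threshold

variable {p : ℕ} [Fact p.Prime] {R : Type*} [CommRing R]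

theorem pow_notMem_frobPow_iff {b : Ideal R} (hb : b ≠ ⊤) {f : R} (hf : f ∈ b.radical) {q k : ℕ}
    (hq : q ≠ 0) : f ^ k ∉ frobPow b q ↔ k ≤ nu (Ideal.span {f}) b q := by
  have h := isGreatest_nu hb hf hq
  have hmem : ∀ k, f ^ k ∉ frobPow b q ↔ k ∈ {k : ℕ | ¬ (Ideal.span {f}) ^ k ≤ frobPow b q} := by
    intro k
    rw [Set.mem_ofPred_eq, Ideal.span_singleton_pow, Ideal.span_singleton_le_iff_mem]
  constructor
  · intro hk
    exact h.2 ((hmem k).1 hk)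
  · intro hk hk'
    exact (hmem _).2 h.1 (Ideal.mem_of_dvd _ (pow_dvd_pow f hk) hk')

theorem fThreshold_le_iff {b : Ideal R} (hb : b ≠ ⊤) {f : R} (hf : f ∈ b.radical) (c : ℝ) :
    fThreshold p (Ideal.span {f}) b ≤ c ↔
      ∀ e k : ℕ, c * (p : ℝ) ^ e < k → f ^ k ∈ frobPow b (p ^ e) := by
  have hp : 0 < p := (Fact.out : p.Prime).pos
  rw [fThreshold, ciSup_le_iff (bddAbove_nu_div hb hf)]
  refine forall_congr' fun e => ?_
  rw [div_le_iff₀ (by positivity)]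
  constructor
  · intro h k hk
    by_contra hk'
    have h1 := (pow_notMem_frobPow_iff hb hf (pow_pos hp e).ne').1 hk'
    have h2 : (k : ℝ) ≤ nu (Ideal.span {f}) b (p ^ e) := by exact_mod_cast h1
    linarith
  · intro h
    by_contra hlt
    exact (pow_notMem_frobPow_iff hb hf (pow_pos hp e).ne').2 le_rfl (h _ (not_le.1 hlt))

theorem nu_le_fThreshold {b : Ideal R} {f : R} (hb : b ≠ ⊤) (hf : f ∈ b.radical)
    (e : ℕ) :
    (nu (Ideal.span {f}) b (p ^ e) : ℝ) ≤ fThreshold p (Ideal.span {f}) b * (p : ℝ) ^ e := by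
  have hp : 0 < p := (Fact.out : p.Prime).pos
  rw [← div_le_iff₀ (by positivity)]
  exact le_ciSup (bddAbove_nu_div (p := p) hb hf) e

end Threshold

/-! ### Rationality with bounded denominators -/

section Perfect

variable {n : ℕ} {L : Type*} [Field L] {p : ℕ} [Fact p.Prime] [CharP L p] [PerfectRing L p]
  {b : Ideal (MvPolynomial (Fin n) L)} {f : MvPolynomial (Fin n) L}

/-- Both bounds come from `f^(k p^s) ∈ b^[p^(i+s)] ↔ f^k ∈ b^[p^i]`, with `k = ν(p^i)` and `k =
ν(p^i) + 1`. -/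
theorem nu_bounds (hb : b ≠ ⊤) (hf : f ∈ b.radical) (i s : ℕ) :
    p ^ s * nu (Ideal.span {f}) b (p ^ i) ≤ nu (Ideal.span {f}) b (p ^ (i + s)) ∧
      nu (Ideal.span {f}) b (p ^ (i + s)) < p ^ s * (nu (Ideal.span {f}) b (p ^ i) + 1) := by
  have hp : 0 < p := (Fact.out : p.Prime).pos
  have hi := fun k => pow_notMem_frobPow_iff hb hf (q := p ^ i) (k := k) (pow_pos hp i).ne'
  have his := fun k => pow_notMem_frobPow_iff hb hf (q := p ^ (i + s)) (k := k) (pow_pos hp _).ne'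
  constructor
  · rw [← his, ← frobPow_frobPow, mul_comm, pow_mul, pow_mem_frobPow_iff, hi]
  · rw [← not_le, ← his, not_not, ← frobPow_frobPow, mul_comm, pow_mul, pow_mem_frobPow_iff,
      ← not_not (a := _ ∈ _), hi]
    omega

theorem fThreshold_le_nu_add_one (hb : b ≠ ⊤) (hf : f ∈ b.radical) (e : ℕ) :
    fThreshold p (Ideal.span {f}) b * (p : ℝ) ^ e ≤ nu (Ideal.span {f}) b (p ^ e) + 1 := by
  have hp : 0 < p := (Fact.out : p.Prime).pos
  rw [← le_div_iff₀ (by positivity)]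
  refine ciSup_le fun s => ?_
  rw [div_le_div_iff₀ (by positivity) (by positivity)]
  -- The two levels `s` and `e` are compared through their common refinement `s + e`.
  have h1 := (nu_bounds (p := p) hb hf s e).1
  have h2 := (nu_bounds (p := p) hb hf e s).2
  rw [add_comm s e] at h1
  have h3 := h1.trans h2.le
  rw [mul_comm, mul_comm _ ((p : ℝ) ^ s)]
  exact_mod_cast h3

/-- The F-thresholds of hypersurfaces of bounded degree are rational, with denominators taken
from a finite set. -/
theorem exists_fThreshold_mul_eq (hb : b ≠ ⊤) {N : ℕ} (hN : f ^ N ∈ b) {D : ℕ}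
    (hD : f.totalDegree ≤ D) :
    ∃ i j c : ℕ, i < j ∧ j ≤ monomialCount n D ∧ c ≤ N * p ^ monomialCount n D ∧
      fThreshold p (Ideal.span {f}) b * ((p : ℝ) ^ j - (p : ℝ) ^ i) = c := by
  classical
  have hprime : p.Prime := Fact.out
  have hp : 0 < p := hprime.pos
  have hf : f ∈ b.radical := ⟨N, hN⟩
  set M := monomialCount n D with hM
  set a : ℕ → ℕ := fun e => nu (Ideal.span {f}) b (p ^ e) with ha
  have hbd : ∀ i s, p ^ s * a i ≤ a (i + s) ∧ a (i + s) < p ^ s * (a i + 1) := nu_bounds hb hf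
  have hdrop : ∀ i s, a (i + s) - p ^ s * a i ∈ drops p f s := fun i s => by
    refine mem_drops (b := b) (i := i) (hbd i s).1 ?_ ?_
    · rw [pow_notMem_frobPow_iff hb hf (pow_pos hp _).ne']
    · rw [← not_not (a := _ ∈ _), pow_notMem_frobPow_iff hb hf (pow_pos hp _).ne']
      simp [ha]
  -- There are `M + 1` indices but at most `M` drops below `p^s`.
  have hpig : ∀ s, ∃ x : Fin (M + 1) × Fin (M + 1), x.1 < x.2 ∧
      a (x.1 + s) - p ^ s * a x.1 = a (x.2 + s) - p ^ s * a x.2 := by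
    intro s
    let r : Fin (M + 1) → ℕ := fun i => a (i + s) - p ^ s * a i
    have hcard : (Finset.univ.image r).card ≤ M := by
      refine card_drops_le (p := p) (s := s) hD _ fun t ht => ?_
      obtain ⟨i, -, rfl⟩ := Finset.mem_image.1 ht
      refine ⟨?_, hdrop i s⟩
      have h := hbd i s
      rw [mul_add, mul_one] at h
      simp only [r]
      omega
    obtain ⟨i, -, j, -, hij, hr⟩ := Finset.exists_ne_map_eq_of_card_lt_of_maps_to
      (s := Finset.univ) (t := Finset.univ.image r) (f := r)
      (by rw [Finset.card_univ, Fintype.card_fin]; omega)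
      (fun i hi => Finset.mem_image_of_mem r hi)
    rcases lt_or_gt_of_ne hij with h | h
    · exact ⟨(i, j), h, hr⟩
    · exact ⟨(j, i), h, hr.symm⟩
  choose x hx1 hx2 using hpig
  obtain ⟨⟨i, j⟩, hinf⟩ := Finite.exists_infinite_fiber x
  have hinf' : (x ⁻¹' {(i, j)}).Infinite := Set.infinite_coe_iff.1 hinf
  have hij : i < j := by
    obtain ⟨s, hs⟩ := hinf'.nonempty
    have := hx1 s
    rw [show x s = (i, j) from hs] at this
    exact this
  have haij : a i ≤ a j := by
    have h := (hbd i (j - i : ℕ)).1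
    rw [Nat.add_sub_cancel' (Fin.lt_def.1 hij).le] at h
    exact (Nat.le_mul_of_pos_left _ (pow_pos hp _)).trans h
  refine ⟨i, j, a j - a i, hij, Nat.lt_succ_iff.1 j.2, ?_, ?_⟩
  · have h1 : a j ≤ N * p ^ (j : ℕ) :=
      le_of_not_pow_le hN _ _ (isGreatest_nu hb hf (pow_pos hp _).ne').1
    have h2 : p ^ (j : ℕ) ≤ p ^ M := Nat.pow_le_pow_right hp (Nat.lt_succ_iff.1 j.2)
    exact (Nat.sub_le _ _).trans (h1.trans (Nat.mul_le_mul_left _ h2))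
  · set t := fThreshold p (Ideal.span {f}) b with ht
    rw [Nat.cast_sub haij]
    by_contra hne
    have hpos : 0 < |t * ((p : ℝ) ^ (j : ℕ) - (p : ℝ) ^ (i : ℕ)) - ((a j : ℝ) - a i)| :=
      abs_pos.2 (sub_ne_zero.2 hne)
    set δ := |t * ((p : ℝ) ^ (j : ℕ) - (p : ℝ) ^ (i : ℕ)) - ((a j : ℝ) - a i)| with hδ
    -- At levels `i + s` and `j + s`, `ν` is at most the scaled threshold and falls short by at most
    -- 1. Equal remainders turn the difference of the two `ν` into `p^s (a j - a i)`. Unbounded `s`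
    -- then forces `δ = 0`.
    have hbound : ∀ s ∈ x ⁻¹' {(i, j)}, (p : ℝ) ^ s * δ ≤ 1 := by
      intro s hs
      have h := hx2 s
      rw [show x s = (i, j) from hs] at h
      have hi := (hbd i s).1
      have hj := (hbd j s).1
      simp only at h
      have h' : (a (i + s) : ℝ) - p ^ s * a i = a (j + s) - p ^ s * a j := by
        rw [← Nat.cast_pow, ← Nat.cast_mul, ← Nat.cast_mul, ← Nat.cast_sub hi, ← Nat.cast_sub hj, h]
      have e1 := nu_le_fThreshold (p := p) hb hf (i + s)
      have e2 := nu_le_fThreshold (p := p) hb hf (j + s)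
      have e3 := fThreshold_le_nu_add_one (p := p) hb hf (i + s)
      have e4 := fThreshold_le_nu_add_one (p := p) hb hf (j + s)
      rw [← ht, pow_add (p : ℝ)] at e1 e2 e3 e4
      change (a (i + s) : ℝ) ≤ _ at e1
      change (a (j + s) : ℝ) ≤ _ at e2
      change _ ≤ (a (i + s) : ℝ) + 1 at e3
      change _ ≤ (a (j + s) : ℝ) + 1 at e4
      rw [hδ, ← abs_of_pos (show (0 : ℝ) < (p : ℝ) ^ s by positivity), ← abs_mul, abs_le]
      constructor <;> linarith
    obtain ⟨m, hm⟩ := pow_unbounded_of_one_lt (1 / δ)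
      (show (1 : ℝ) < p by exact_mod_cast hprime.one_lt)
    obtain ⟨s, hs, hms⟩ := hinf'.exists_gt m
    have h1 := hbound s hs
    have h2 : (p : ℝ) ^ m ≤ (p : ℝ) ^ s :=
      pow_le_pow_right₀ (by exact_mod_cast hp) hms.le
    rw [← le_div_iff₀ hpos] at h1
    linarith

end Perfect

/-! ### Monomial ideals and change of field -/

theorem mem_frobPow_monomial_iff {σ L : Type*} [Field L] {p : ℕ} [Fact p.Prime] [CharP L p]
    {S : Set (σ →₀ ℕ)} {e : ℕ} {f : MvPolynomial σ L} :
    f ∈ frobPow (Ideal.span ((fun d => monomial d (1 : L)) '' S)) (p ^ e) ↔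
      ∀ d, (∀ s ∈ S, ¬ p ^ e • s ≤ d) → coeff d f = 0 := by
  have h : frobPow (Ideal.span ((fun d => monomial d (1 : L)) '' S)) (p ^ e) =
      Ideal.span ((fun d => monomial d (1 : L)) '' ((fun s => p ^ e • s) '' S)) := by
    rw [frobPow_eq_map, Ideal.map_span, Set.image_image, Set.image_image]
    simp only [iterateFrobenius_def, monomial_pow, one_pow]
  rw [h, mem_ideal_span_monomial_image]
  refine forall_congr' fun d => ?_
  rw [mem_support_iff]
  simp only [Set.exists_mem_image]
  constructor
  · intro hd hS
    by_contra hne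
    obtain ⟨s, hs, hsd⟩ := hd hne
    exact hS s hs hsd
  · intro hd hne
    by_contra hS
    push Not at hS
    exact hne (hd hS)

section Extension

variable {σ k : Type*} [Field k] (L : Type*) [Field L] [Algebra k L]

theorem extend_span_monomial (S : Set (σ →₀ ℕ)) :
    extend L (Ideal.span ((fun d => monomial d (1 : k)) '' S)) =
      Ideal.span ((fun d => monomial d (1 : L)) '' S) := by
  rw [extend, Ideal.map_span, Set.image_image]
  simp only [map_monomial, map_one]

theorem extend_ne_top {b : Ideal (MvPolynomial σ k)} (hb : IsMonomialIdeal b) (hb' : b ≠ ⊤) :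
    extend L b ≠ ⊤ := by
  classical
  obtain ⟨S, rfl⟩ := hb
  rw [extend_span_monomial]
  intro h
  apply hb'
  have h1 := (Ideal.eq_top_iff_one _).1 h
  rw [Ideal.eq_top_iff_one, mem_ideal_span_monomial_image]
  intro d hd
  refine (mem_ideal_span_monomial_image.1 h1) d ?_
  simp only [mem_support_iff, coeff_one, ne_eq, ite_eq_right_iff, one_ne_zero, imp_false] at hd ⊢
  exact hd

variable {m : ℕ} {L} (g : Fin m → MvPolynomial σ k)

/-- A power of the finitely generated ideal of the `g i` lies in `b`, so one `N` serves every `L`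
and `γ`. -/
theorem exists_linComb_pow_mem {b : Ideal (MvPolynomial σ k)}
    (hab : Ideal.span (Set.range g) ≤ b.radical) :
    ∃ N : ℕ, ∀ (L : Type v) [Field L] [Algebra k L] (γ : Fin m → L),
      linComb g γ ^ N ∈ extend L b := by
  obtain ⟨N, hN⟩ := Ideal.exists_pow_le_of_le_radical_of_fg hab
    (Submodule.fg_span (Set.finite_range g))
  refine ⟨N, fun L _ _ γ => ?_⟩
  have h1 : linComb g γ ∈ (Ideal.span (Set.range g)).map (MvPolynomial.map (algebraMap k L)) :=
    Ideal.sum_mem _ fun i _ => Ideal.mul_mem_left _ _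
      (Ideal.mem_map_of_mem _ (Ideal.subset_span ⟨i, rfl⟩))
  have h2 := Ideal.pow_mem_pow h1 N
  rw [← Ideal.map_pow] at h2
  exact Ideal.map_mono hN h2

theorem totalDegree_linComb_le (γ : Fin m → L) :
    (linComb g γ).totalDegree ≤ Finset.univ.sup fun i => (g i).totalDegree := by
  refine totalDegree_finsetSum_le fun i hi => ?_
  refine (totalDegree_mul _ _).trans ?_
  rw [totalDegree_C, zero_add]
  exact (Finset.sup_mono (support_map_subset _ _)).trans
    (Finset.le_sup (f := fun i => (g i).totalDegree) hi)

/-- The linear combination of the `g i` with indeterminate coefficients. -/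
noncomputable def genericComb : MvPolynomial σ (MvPolynomial (Fin m) k) :=
  ∑ i, C (X i) * MvPolynomial.map C (g i)

theorem map_genericComb (γ : Fin m → L) :
    MvPolynomial.map (aeval γ : MvPolynomial (Fin m) k →ₐ[k] L).toRingHom (genericComb g) =
      linComb g γ := by
  simp only [genericComb, linComb, map_sum, map_mul, map_C, MvPolynomial.map_map]
  refine Finset.sum_congr rfl fun i _ => ?_
  congr 2
  · simp
  · congr 1
    ext x
    simp

theorem coeff_linComb_pow (γ : Fin m → L) (j : ℕ) (d : σ →₀ ℕ) :
    coeff d (linComb g γ ^ j) = aeval γ (coeff d (genericComb g ^ j)) := by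
  rw [← map_genericComb, ← map_pow, coeff_map]
  rfl

theorem linComb_pow_mem_iff {p : ℕ} [Fact p.Prime] [CharP L p] (S : Set (σ →₀ ℕ))
    (γ : Fin m → L) (j e : ℕ) :
    linComb g γ ^ j ∈
        frobPow (extend L (Ideal.span ((fun d => monomial d (1 : k)) '' S))) (p ^ e) ↔
      ∀ d, (∀ s ∈ S, ¬ p ^ e • s ≤ d) → aeval γ (coeff d (genericComb g ^ j)) = 0 := by
  simp only [extend_span_monomial, mem_frobPow_monomial_iff, coeff_linComb_pow]

/-- Each membership defining `ν` is the vanishing of elements of `L`, which the injection into `K`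
preserves and reflects. -/
theorem fThreshold_extension {p : ℕ} [Fact p.Prime] [CharP L p] (K : Type*) [Field K]
    [Algebra k K] [Algebra L K] [IsScalarTower k L K] {b : Ideal (MvPolynomial σ k)}
    (hb : IsMonomialIdeal b) (γ : Fin m → L) :
    fThreshold p (Ideal.span {linComb g (algebraMap L K ∘ γ)}) (extend K b) =
      fThreshold p (Ideal.span {linComb g γ}) (extend L b) := by
  obtain ⟨S, rfl⟩ := hb
  have : CharP K p := charP_of_injective_algebraMap (algebraMap L K).injective p
  simp only [fThreshold, nu, Ideal.span_singleton_pow, Ideal.span_singleton_le_iff_mem,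
    linComb_pow_mem_iff, aeval_algebraMap_apply, map_eq_zero]

end Extension

/-! ### Finiteness and equations for the thresholds -/

theorem finite_setOf_mul_pow_sub_pow_eq {p : ℕ} (hp : 1 < p) (M B : ℕ) :
    {t : ℝ | ∃ i j c : ℕ, i < j ∧ j ≤ M ∧ c ≤ B ∧
      t * ((p : ℝ) ^ j - (p : ℝ) ^ i) = c}.Finite := by
  refine (((Set.finite_Iic M).prod ((Set.finite_Iic M).prod (Set.finite_Iic B))).image
    fun x : ℕ × ℕ × ℕ => (x.2.2 : ℝ) / ((p : ℝ) ^ x.2.1 - (p : ℝ) ^ x.1)).subset ?_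
  rintro t ⟨i, j, c, hij, hj, hc, ht⟩
  refine ⟨(i, j, c), ⟨hij.le.trans hj, hj, hc⟩, ?_⟩
  have h : (p : ℝ) ^ i < (p : ℝ) ^ j := pow_lt_pow_right₀ (by exact_mod_cast hp) hij
  exact (eq_div_of_mul_eq (sub_pos.2 h).ne' ht).symm

theorem thresholds_finite (p : ℕ) [Fact p.Prime] {k : Type u} [Field k] {n m : ℕ}
    (g : Fin m → MvPolynomial (Fin n) k) {b : Ideal (MvPolynomial (Fin n) k)}
    (hb : IsMonomialIdeal b) (hb' : b ≠ ⊤) (hab : Ideal.span (Set.range g) ≤ b.radical) :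
    (thresholds.{u, v} p g b).Finite := by
  obtain ⟨N, hN⟩ := exists_linComb_pow_mem.{v} g hab
  let D := Finset.univ.sup fun i => (g i).totalDegree
  refine (finite_setOf_mul_pow_sub_pow_eq (Fact.out : p.Prime).one_lt (monomialCount n D)
    (N * p ^ monomialCount n D)).subset ?_
  rintro t ⟨L, _, _, _, -, γ, -, rfl⟩
  -- The rationality result needs a perfect field, which `L` need not be.
  have : CharP (AlgebraicClosure L) p :=
    charP_of_injective_algebraMap (algebraMap L _).injective p
  rw [← fThreshold_extension g (AlgebraicClosure L) hb γ]
  exact exists_fThreshold_mul_eq (extend_ne_top _ hb hb') (hN _ _) (totalDegree_linComb_le g _)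

theorem fThreshold_mem_thresholds {p : ℕ} [Fact p.Prime] {k : Type u} [Field k] {n m : ℕ}
    {L : Type v} [hF : Field L] [hA : Algebra k L] [hC : CharP L p] (hL : IsFFinite p L)
    (g : Fin m → MvPolynomial (Fin n) k) (b : Ideal (MvPolynomial (Fin n) k)) {γ : Fin m → L}
    (hγ : linComb g γ ≠ 0) :
    fThreshold p (Ideal.span {linComb g γ}) (extend L b) ∈ thresholds.{u, v} p g b :=
  ⟨L, hF, hA, hC, hL, γ, hγ, rfl⟩

/-- The equations in the coefficients of a linear combination of the `g i` for its F-threshold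
with respect to the monomial ideal generated by the exponents in `S` to be at most `c`. -/
def thresholdEquations (p : ℕ) {σ k : Type*} [Field k] {m : ℕ} (g : Fin m → MvPolynomial σ k)
    (S : Set (σ →₀ ℕ)) (c : ℝ) : Set (MvPolynomial (Fin m) k) :=
  {h | ∃ (e j : ℕ) (d : σ →₀ ℕ), c * (p : ℝ) ^ e < j ∧ (∀ s ∈ S, ¬ p ^ e • s ≤ d) ∧
    coeff d (genericComb g ^ j) = h}

theorem fThreshold_le_iff_mem_baseChange {p : ℕ} [Fact p.Prime] {σ k L : Type*} [Field k]
    [Field L] [Algebra k L] [CharP L p] {m : ℕ} (g : Fin m → MvPolynomial σ k)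
    {S : Set (σ →₀ ℕ)} (hb' : Ideal.span ((fun d => monomial d (1 : k)) '' S) ≠ ⊤)
    (hab : Ideal.span (Set.range g) ≤ (Ideal.span ((fun d => monomial d (1 : k)) '' S)).radical)
    (γ : Fin m → L) (c : ℝ) :
    fThreshold p (Ideal.span {linComb g γ})
        (extend L (Ideal.span ((fun d => monomial d (1 : k)) '' S))) ≤ c ↔
      ratPoint γ ∈ baseChange L (PrimeSpectrum.zeroLocus (thresholdEquations p g S c)) := by
  obtain ⟨N, hN⟩ := exists_linComb_pow_mem g hab
  rw [fThreshold_le_iff (extend_ne_top L ⟨S, rfl⟩ hb') ⟨N, hN L γ⟩,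
    ratPoint_mem_baseChange_zeroLocus]
  simp only [linComb_pow_mem_iff]
  constructor
  · rintro h _ ⟨e, j, d, hj, hd, rfl⟩
    exact h e j hj d hd
  · intro h e j hj d hd
    exact h _ ⟨e, j, d, hj, hd, rfl⟩

end FThr

theorem mainTheorem4 (p : ℕ) [Fact p.Prime] {k : Type u} [Field k] [CharP k p]
    (hk : FThr.IsFFinite p k) {n m : ℕ}
    (g : Fin m → MvPolynomial (Fin n) k) (hg : ∀ i, g i ≠ 0)
    (ha : Ideal.span (Set.range g) ≠ ⊤)
    (b : Ideal (MvPolynomial (Fin n) k)) (hb : FThr.IsMonomialIdeal b) (hb' : b ≠ ⊤)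
    (hab : Ideal.span (Set.range g) ≤ b.radical) :
    (FThr.thresholds.{u, v} p g b).Finite ∧
    ∀ t ∈ FThr.thresholds.{u, v} p g b,
      ∃ Z : Set (FThr.Aff m k), IsLocallyClosed Z ∧
        ∀ (L : Type v) [Field L] [Algebra k L] [CharP L p], FThr.IsFFinite p L →
          ∀ γ : Fin m → L, FThr.linComb g γ ≠ 0 →
            (FThr.fThreshold p (Ideal.span {FThr.linComb g γ}) (FThr.extend L b) = t ↔
              FThr.ratPoint γ ∈ FThr.baseChange L Z) := by
  have hfin := FThr.thresholds_finite.{u, v} p g hb hb' hab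
  refine ⟨hfin, fun t _ => ?_⟩
  obtain ⟨S, rfl⟩ := hb
  let V : ℝ → Set (FThr.Aff m k) := fun c =>
    PrimeSpectrum.zeroLocus (FThr.thresholdEquations p g S c)
  -- Only attained values below `t` are removed; their finiteness keeps the union closed.
  let T := {s ∈ FThr.thresholds.{u, v} p g (Ideal.span ((fun d => monomial d (1 : k)) '' S)) |
    s < t}
  have hclosed : IsClosed (⋃ s ∈ T, V s) :=
    (hfin.subset (Set.sep_subset _ _)).isClosed_biUnion fun s _ =>
      PrimeSpectrum.isClosed_zeroLocus _
  refine ⟨V t ∩ (⋃ s ∈ T, V s)ᶜ, (PrimeSpectrum.isClosed_zeroLocus _).isLocallyClosed.inter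
    hclosed.isOpen_compl.isLocallyClosed, fun L _ _ _ hL γ hγ => ?_⟩
  have key : ∀ c, _ ↔ FThr.ratPoint γ ∈ FThr.baseChange L (V c) :=
    FThr.fThreshold_le_iff_mem_baseChange (p := p) g hb' hab γ
  have hmem : FThr.ratPoint γ ∈ FThr.baseChange L (V t ∩ (⋃ s ∈ T, V s)ᶜ) ↔
      FThr.ratPoint γ ∈ FThr.baseChange L (V t) ∧
        ∀ s ∈ T, FThr.ratPoint γ ∉ FThr.baseChange L (V s) := by
    simp only [FThr.baseChange, Set.mem_preimage, Set.mem_inter_iff, Set.mem_compl_iff,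
      Set.mem_iUnion, not_exists]
  rw [hmem, ← key]
  simp only [← key]
  constructor
  · intro h
    exact ⟨h.le, fun s hs hle => (h ▸ hle).not_gt hs.2⟩
  · rintro ⟨hle, hT⟩
    by_contra hne
    -- A threshold below `t` would itself belong to `T`, so its own closed set has been removed.
    exact hT _ ⟨FThr.fThreshold_mem_thresholds hL g _ hγ, lt_of_le_of_ne hle hne⟩ le_rfl
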